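/- **Setting.** Let $L,M>0$. Let $S\subseteq\mathbb R^d$ be an open convex set of points of interest (for example $S=\mathbb R^d$), and let $f:\mathbb R^d\to\mathbb R$ be twice differentiable on $S$, with $L$-Lipschitz gradient and $M$-Lipschitz Hessian on $S$ (Euclidean and spectral norm), and $f\ge\bar f$ on $S$. **Algorithm.** Given $\epsilon_g,\epsilon_H>0$, a stepsize bound $\alpha\ge\epsilon_H$ and $x_0$, at iteration $k=0,1,2,\dots$ the algorithm receives an inexact gradient $g_k$. If $\|g_k\|>\epsilon_g$, it sets $x_{k+1}=x_k-\frac1L g_k$. Otherwise it receives a symmetric matrix $H_k$ and a unit vector $\hat p_k$, and computes $\hat\lambda_k=\hat p_k^TH_k\hat p_k$. If $\hat\lambda_k<-\epsilon_H$, it takes some $\alpha_k\in[\epsilon_H,\min(\alpha,|\hat\lambda_k|)]$, draws a fair sign $\sigma_k=\pm1$ independent of everything that happened before, and sets $x_{k+1}=x_k+\frac{2\alpha_k}{M}\sigma_k\hat p_k$. If $\hat\lambda_k\ge-\epsilon_H$, it terminates and returns $x_k$. The quantities received at iteration $k$ do not anticipate $\sigma_k,\sigma_{k+1},\dots$. All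 iterates lie in $S$, and at every iteration that takes place $$\|g_k-\nabla f(x_k)\|\le\tfrac13\max\{\epsilon_g,\|g_k\|\},$$ and, whenever $H_k$ is requested, $$\|H_k-\nabla^2f(x_k)\|\le\tfrac29\epsilon_H,\qquad|\hat\lambda_k-\lambda_{\min}(H_k)|\le\tfrac19\epsilon_H .$$ **Constants.** Put $\Delta=f(x_0)-\bar f$, $C_\epsilon=\min\left(\frac{\epsilon_g^2}{6L},\frac{2\epsilon_H^3}{9M^2}\right)$, $B=1+\frac{18\alpha L}{M\epsilon_g}$, $C=2304\,\frac{M^2\alpha^2\epsilon_g^2}{\epsilon_H^6}$. For an integer $\eta\ge2$ and $\delta\in(0,1)$ put $$K=\max\left\{C\log\tfrac1\delta,\;4\eta C\left(\tfrac{\Delta}{C_\epsilon}\right)^{1/\eta},\;4\eta^2C^{1+\frac1{\eta-1}}B^{\frac1{\eta-1}}\right\},\qquad n=\frac{2\Delta}{C_\epsilon}+BK .$$ **Corollary.** Let $\epsilon_g=\epsilon$, let $\epsilon_H=\epsilon_H(\epsilon)>0$ be determined by $\frac{\epsilon_g^2}{6L}=\frac{2\epsilon_H^3}{9M^2}$,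 and take $\alpha_k=\alpha=\epsilon_H$. Then, as $\epsilon\to0^+$ and with implied constants depending only on $L$ and $M$, $$\epsilon_H=\Theta(\epsilon^{2/3}),\qquad C=O(1/\epsilon_H)=O(\epsilon^{-2/3}),\qquad B=O(\epsilon^{-1/3}).$$ With $\eta=2$: for every $\epsilon>0$ and $\delta\in(0,1)$ the algorithm terminates within $n$ iterations with probability at least $1-\delta$. Moreover $n=\tilde O(\epsilon^{-2})$ as $\epsilon\to0^+$ for fixed $\Delta\ge0$ and $\delta\in(0,1)$, where $u=\tilde O(v)$ means $u=O(v\log^kv)$ for some constant $k$. More precisely, there are $c$, $k$ and $\epsilon_0>0$ depending only on $L$ and $M$ with $$n\le c\left(1+\Delta+\log\tfrac1\delta\right)\epsilon^{-2}\log^k(\epsilon^{-2})\qquad\text{for all }\epsilon\in(0,\epsilon_0),\ \Delta\ge0,\ \delta\in(0,1).$$ -/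

import Mathlib

open Filter Topology Asymptotics MeasureTheory ProbabilityTheory

namespace InexactSOSP

/-- `ℝ^d` with the Euclidean norm. -/
abbrev Vec (d : ℕ) : Type := EuclideanSpace ℝ (Fin d)

/-- The Hessian `∇²f(x)`, the derivative of the gradient, as a linear operator on `ℝ^d`.
The norm of `Vec d →L[ℝ] Vec d` is the operator (spectral) norm. -/
noncomputable def hessian {d : ℕ} (f : Vec d → ℝ) (x : Vec d) : Vec d →L[ℝ] Vec d :=
  fderiv ℝ (gradient f) x

/-- The smallest eigenvalue of an operator (used for self-adjoint operators only). -/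
noncomputable def minEigenvalue {d : ℕ} (A : Vec d →L[ℝ] Vec d) : ℝ :=
  sInf {lam : ℝ | Module.End.HasEigenvalue (A : Vec d →ₗ[ℝ] Vec d) lam}

/-- The basic assumption on the objective, on an open convex set `S` of points of interest
(`S = Set.univ` is allowed): `f` is twice differentiable, its gradient is `L`-Lipschitz,
its Hessian is `M`-Lipschitz, and `f` is bounded below by `fbar`. -/
structure SmoothObjective {d : ℕ} (S : Set (Vec d)) (f : Vec d → ℝ) (L M fbar : ℝ) : Prop where
  isOpen : IsOpen S
  convex : Convex ℝ S
  differentiable : ∀ x ∈ S, DifferentiableAt ℝ f x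
  gradient_differentiable : ∀ x ∈ S, DifferentiableAt ℝ (gradient f) x
  gradient_lipschitz : ∀ x ∈ S, ∀ y ∈ S, ‖gradient f x - gradient f y‖ ≤ L * ‖x - y‖
  hessian_lipschitz : ∀ x ∈ S, ∀ y ∈ S, ‖hessian f x - hessian f y‖ ≤ M * ‖x - y‖
  bounded_below : ∀ x ∈ S, fbar ≤ f x

/-! ### The algorithm -/

/-- What the algorithm is given in one iteration: the inexact gradient `g_k`, the inexact Hessian
`H_k`, the approximate minimal eigenvector `p_k`, and the negative curvature stepsize `α_k`. -/
structure Reply (d : ℕ) where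
  grad : Vec d
  hess : Vec d →L[ℝ] Vec d
  dir : Vec d
  step : ℝ

/-- The approximate minimal eigenvalue `p_kᵀ H_k p_k`. -/
noncomputable def Reply.curv {d : ℕ} (r : Reply d) : ℝ := inner ℝ r.dir (r.hess r.dir)

/-- The algorithm stops and returns the current iterate. -/
def Stops {d : ℕ} (εg εH : ℝ) (r : Reply d) : Prop :=
  ¬ (εg < ‖r.grad‖) ∧ ¬ (r.curv < -εH)

/-- One pass through the loop: a gradient step, a negative curvature step with sign `s`, or
(when the algorithm stops) no move. -/
noncomputable def nextIterate {d : ℕ} (L M εg εH : ℝ) (x : Vec d) (r : Reply d) (s : ℝ) : Vec d :=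
  if εg < ‖r.grad‖ then x - (1 / L) • r.grad
  else if r.curv < -εH then x + (2 * r.step / M * s) • r.dir
  else x

/-- The iterates `x_k` of the algorithm started at `x₀`, when it receives the replies `r k ω` and
draws the signs `σ k ω`. After termination the iterate no longer changes. -/
noncomputable def iterate {d : ℕ} {Ω : Type*} (L M εg εH : ℝ) (x₀ : Vec d)
    (r : ℕ → Ω → Reply d) (σ : ℕ → Ω → ℝ) : ℕ → Ω → Vec d
  | 0, _ => x₀
  | k + 1, ω => nextIterate L M εg εH (iterate L M εg εH x₀ r σ k ω) (r k ω) (σ k ω)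

/-- Iteration `k` takes place: the algorithm has not stopped at an earlier iteration. -/
def Reached {d : ℕ} {Ω : Type*} (εg εH : ℝ) (r : ℕ → Ω → Reply d) (k : ℕ) (ω : Ω) : Prop :=
  ∀ j < k, ¬ Stops εg εH (r j ω)

/-- The algorithm terminates at some iteration `k ≤ n` (`n` need not be an integer). -/
def TerminatesWithin {d : ℕ} {Ω : Type*} (εg εH : ℝ) (r : ℕ → Ω → Reply d) (n : ℝ)
    (ω : Ω) : Prop :=
  ∃ k : ℕ, (k : ℝ) ≤ n ∧ Stops εg εH (r k ω)

/-- The signs `σ_k` are fair `±1` coin flips. `ℱ k` is the information available before the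
`k`-th coin is flipped; the `k`-th coin is independent of it and is known at time `k + 1`. -/
structure FairSigns {Ω : Type*} [mΩ : MeasurableSpace Ω] (μ : Measure Ω) (ℱ : Filtration ℕ mΩ)
    (σ : ℕ → Ω → ℝ) : Prop where
  measurable : ∀ k, Measurable[ℱ (k + 1)] (σ k)
  values : ∀ k ω, σ k ω = 1 ∨ σ k ω = -1
  prob_pos : ∀ k, μ {ω | σ k ω = 1} = 1 / 2
  prob_neg : ∀ k, μ {ω | σ k ω = -1} = 1 / 2
  indep : ∀ k, Indep (ℱ k) (MeasurableSpace.comap (σ k) inferInstance) μ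

/-- The replies at iteration `k` depend only on the information available before the `k`-th
coin is flipped (they may depend on the whole history and on further randomness). -/
structure AdaptedReplies {d : ℕ} {Ω : Type*} [mΩ : MeasurableSpace Ω] (ℱ : Filtration ℕ mΩ)
    (r : ℕ → Ω → Reply d) : Prop where
  grad : ∀ k, Measurable[ℱ k] (fun ω => (r k ω).grad)
  hess : ∀ k, Measurable[ℱ k] (fun ω => (r k ω).hess)
  dir : ∀ k, Measurable[ℱ k] (fun ω => (r k ω).dir)
  step : ∀ k, Measurable[ℱ k] (fun ω => (r k ω).step)

/-- The relative accuracy required of the gradient received at `x`. -/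
def AccurateGradient {d : ℕ} (f : Vec d → ℝ) (εg : ℝ) (x : Vec d) (r : Reply d) : Prop :=
  ‖r.grad - gradient f x‖ ≤ 1 / 3 * max εg ‖r.grad‖

/-- The accuracy required of the (symmetric) Hessian received at `x`. -/
def AccurateHessian {d : ℕ} (f : Vec d → ℝ) (εH : ℝ) (x : Vec d) (r : Reply d) : Prop :=
  IsSelfAdjoint r.hess ∧ ‖r.hess - hessian f x‖ ≤ 2 / 9 * εH

/-- The received direction is a unit vector whose Rayleigh quotient is within `εH / 9` of the
smallest eigenvalue of the received Hessian. -/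
def AccurateEigenvector {d : ℕ} (εH : ℝ) (r : Reply d) : Prop :=
  ‖r.dir‖ = 1 ∧ |r.curv - minEigenvalue r.hess| ≤ 1 / 9 * εH

/-- All requirements on the replies along the run of the algorithm with stepsize bound `α`. They
are imposed only at iterations that take place, those on the Hessian and the eigenvector only when
a Hessian is requested (that is, when no gradient step is taken), and the one on `α_k` only when a
negative curvature step is taken. -/
structure ValidRun {d : ℕ} {Ω : Type*} (S : Set (Vec d)) (f : Vec d → ℝ) (L M εg εH α : ℝ)
    (x₀ : Vec d) (r : ℕ → Ω → Reply d) (σ : ℕ → Ω → ℝ) : Prop where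
  mem : ∀ k ω, Reached εg εH r k ω → iterate L M εg εH x₀ r σ k ω ∈ S
  gradient : ∀ k ω, Reached εg εH r k ω →
    AccurateGradient f εg (iterate L M εg εH x₀ r σ k ω) (r k ω)
  hessian : ∀ k ω, Reached εg εH r k ω → ‖(r k ω).grad‖ ≤ εg →
    AccurateHessian f εH (iterate L M εg εH x₀ r σ k ω) (r k ω)
  eigenvector : ∀ k ω, Reached εg εH r k ω → ‖(r k ω).grad‖ ≤ εg →
    AccurateEigenvector εH (r k ω)
  step : ∀ k ω, Reached εg εH r k ω → ‖(r k ω).grad‖ ≤ εg → (r k ω).curv < -εH →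
    (r k ω).step ∈ Set.Icc εH (min α |(r k ω).curv|)

/-! ### The constants of the complexity bound (`Δ` stands for `f(x₀) - fbar`) -/

/-- `C_ε = min (εg² / (6L)) (2 εH³ / (9M²))`. -/
noncomputable def decrease (L M εg εH : ℝ) : ℝ :=
  min (εg ^ 2 / (6 * L)) (2 * εH ^ 3 / (9 * M ^ 2))

/-- `B = 1 + 18 α L / (M εg)`. -/
noncomputable def constB (L M α εg : ℝ) : ℝ := 1 + 18 * α * L / (M * εg)

/-- `C = 2304 M² α² εg² / εH⁶`. -/
noncomputable def constC (M α εg εH : ℝ) : ℝ := 2304 * (M ^ 2 * α ^ 2 * εg ^ 2 / εH ^ 6)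

/-- `K = max {C log(1/δ), 4 η C (Δ/C_ε)^(1/η), 4 η² C^(1 + 1/(η-1)) B^(1/(η-1))}`. -/
noncomputable def constK (L M α εg εH Δ δ : ℝ) (η : ℕ) : ℝ :=
  max (constC M α εg εH * Real.log (1 / δ))
    (max (4 * η * constC M α εg εH * (Δ / decrease L M εg εH) ^ (1 / (η : ℝ)))
      (4 * (η : ℝ) ^ 2 * constC M α εg εH ^ (1 + 1 / ((η : ℝ) - 1)) *
        constB L M α εg ^ (1 / ((η : ℝ) - 1))))

/-- The iteration bound `n = 2 Δ / C_ε + B K`. -/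
noncomputable def iterBound (L M α εg εH Δ δ : ℝ) (η : ℕ) : ℝ :=
  2 * (Δ / decrease L M εg εH) + constB L M α εg * constK L M α εg εH Δ δ η

/-- `u = Õ(v)` along the filter `l`: `u = O(v log^k v)` for some constant `k`. -/
def IsBigOTilde {ι : Type*} (l : Filter ι) (u v : ι → ℝ) : Prop :=
  ∃ k : ℕ, u =O[l] fun i => v i * Real.log (v i) ^ k

end InexactSOSP

namespace InexactSOSP

/-! Termination is a descent argument with noise. By the Taylor bounds, an iteration that does not
stop lowers `f` by at least c = C_ε, up to a term u_k σ_k: the first order part of a negative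
curvature step. Its coefficient u_k is known before σ_k is drawn and is at most b = 8 ε_H ε_g / (3M)
in size, because such steps occur only where the gradient is small. A run still alive after T > n
iterations satisfies T c - Δ ≤ ∑ u_k σ_k. As n ≥ 2Δ/c, the noise then averages at least c/2, an
event that Azuma's inequality bounds by exp(-c²T/(8b²)) = exp(-2T/C) ≤ δ. This needs only n ≥ 2Δ/c +
C log(1/δ), hence only the first entry of K and B ≥ 1. Taking α = ε_H fixes the curvature stepsize,
which keeps b uniform.

For the asymptotics, put y = ε^(1/3). The coupling forces ε_H = κ y², and then C, B and C_ε have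
orders y⁻², y⁻¹ and y⁶. With η = 2 this gives K = O(y⁻⁵) and n = O(y⁻⁶) = O(ε⁻²), with no logarithm
in ε. -/

/-- A function whose derivative on `[0, 1]` is at most that of `g` grows at most as much. -/
lemma sub_le_sub_of_hasDerivAt_le {φ g φ' g' : ℝ → ℝ}
    (hφ : ∀ t ∈ Set.Icc (0 : ℝ) 1, HasDerivAt φ (φ' t) t)
    (hg : ∀ t ∈ Set.Icc (0 : ℝ) 1, HasDerivAt g (g' t) t)
    (hle : ∀ t ∈ Set.Icc (0 : ℝ) 1, φ' t ≤ g' t) {t : ℝ} (ht : t ∈ Set.Icc (0 : ℝ) 1) :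
    φ t - φ 0 ≤ g t - g 0 := by
  have hd : ∀ s ∈ Set.Icc (0 : ℝ) 1, HasDerivAt (fun s => g s - φ s) (g' s - φ' s) s :=
    fun s hs => (hg s hs).sub (hφ s hs)
  have hmono : MonotoneOn (fun s => g s - φ s) (Set.Icc 0 1) := by
    refine monotoneOn_of_deriv_nonneg (convex_Icc 0 1)
      (fun s hs => (hd s hs).continuousAt.continuousWithinAt) ?_ ?_
    · intro s hs
      exact (hd s (interior_subset hs)).differentiableAt.differentiableWithinAt
    · intro s hs
      rw [(hd s (interior_subset hs)).deriv]
      exact sub_nonneg.2 (hle s (interior_subset hs))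
  have := hmono (Set.left_mem_Icc.2 zero_le_one) ht ht.1
  simp only at this
  linarith

/-! ### Taylor bounds and the decrease in one step -/

section Taylor

variable {d : ℕ} {S : Set (Vec d)} {f : Vec d → ℝ} {L M fbar : ℝ}

lemma SmoothObjective.add_smul_mem (h : SmoothObjective S f L M fbar) {x s : Vec d} (hx : x ∈ S)
    (hxs : x + s ∈ S) {t : ℝ} (ht : t ∈ Set.Icc (0 : ℝ) 1) : x + t • s ∈ S :=
  h.convex.add_smul_mem hx hxs ht

lemma hasDerivAt_add_smul (x s : Vec d) (t : ℝ) : HasDerivAt (fun t : ℝ => x + t • s) s t := by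
  simpa using ((hasDerivAt_id t).smul_const s).const_add x

lemma SmoothObjective.hasDerivAt_line (h : SmoothObjective S f L M fbar) {x s : Vec d} {t : ℝ}
    (hx : x + t • s ∈ S) :
    HasDerivAt (fun t : ℝ => f (x + t • s)) (inner ℝ (gradient f (x + t • s)) s) t := by
  have h1 := (h.differentiable _ hx).hasGradientAt.hasFDerivAt.comp_hasDerivAt t
    (hasDerivAt_add_smul x s t)
  exact h1.congr_deriv (by simp)

lemma SmoothObjective.hasDerivAt_gradient_line (h : SmoothObjective S f L M fbar) {x s : Vec d}
    {t : ℝ} (hx : x + t • s ∈ S) :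
    HasDerivAt (fun t : ℝ => inner ℝ (gradient f (x + t • s)) s)
      (inner ℝ (hessian f (x + t • s) s) s) t := by
  have h1 := (h.gradient_differentiable _ hx).hasFDerivAt.comp_hasDerivAt t
    (hasDerivAt_add_smul x s t)
  exact (h1.inner ℝ (hasDerivAt_const t s)).congr_deriv (by simp [hessian])

/-- The quadratic upper bound of a function with Lipschitz gradient. -/
lemma SmoothObjective.le_quadratic (h : SmoothObjective S f L M fbar) {x s : Vec d} (hx : x ∈ S)
    (hxs : x + s ∈ S) :
    f (x + s) ≤ f x + inner ℝ (gradient f x) s + L / 2 * ‖s‖ ^ 2 := by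
  have key := sub_le_sub_of_hasDerivAt_le (t := 1)
    (g := fun t => t * inner ℝ (gradient f x) s + L / 2 * t ^ 2 * ‖s‖ ^ 2)
    (g' := fun t => inner ℝ (gradient f x) s + L * t * ‖s‖ ^ 2)
    (fun t ht => h.hasDerivAt_line (h.add_smul_mem hx hxs ht))
    (fun t _ => by
      have h1 := ((hasDerivAt_id t).mul_const (inner ℝ (gradient f x) s : ℝ)).add
        ((((hasDerivAt_id t).pow 2).const_mul (L / 2)).mul_const (‖s‖ ^ 2))
      refine h1.congr_deriv ?_
      simp [-mul_eq_mul_right_iff]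
      ring)
    (fun t ht => by
      have h1 := h.gradient_lipschitz _ (h.add_smul_mem hx hxs ht) _ hx
      rw [add_sub_cancel_left, norm_smul, Real.norm_of_nonneg ht.1] at h1
      have h2 := real_inner_le_norm (gradient f (x + t • s) - gradient f x) s
      rw [inner_sub_left] at h2
      nlinarith [norm_nonneg s])
    (Set.right_mem_Icc.2 zero_le_one)
  simp only [one_smul, zero_smul, add_zero] at key
  linarith

/-- The cubic upper bound of a function with Lipschitz Hessian. -/
lemma SmoothObjective.le_cubic (h : SmoothObjective S f L M fbar) {x s : Vec d} (hx : x ∈ S)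
    (hxs : x + s ∈ S) :
    f (x + s) ≤ f x + inner ℝ (gradient f x) s + 1 / 2 * inner ℝ (hessian f x s) s
      + M / 6 * ‖s‖ ^ 3 := by
  -- The Lipschitz bound on the Hessian, integrated once along the segment; integrating again gives
  -- the cubic bound.
  have hgrad : ∀ t ∈ Set.Icc (0 : ℝ) 1, inner ℝ (gradient f (x + t • s)) s ≤
      inner ℝ (gradient f x) s + t * inner ℝ (hessian f x s) s + M / 2 * t ^ 2 * ‖s‖ ^ 3 := by
    intro t ht
    have key := sub_le_sub_of_hasDerivAt_le
      (g := fun t => t * inner ℝ (hessian f x s) s + M / 2 * t ^ 2 * ‖s‖ ^ 3)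
      (g' := fun t => inner ℝ (hessian f x s) s + M * t * ‖s‖ ^ 3)
      (fun t ht => h.hasDerivAt_gradient_line (h.add_smul_mem hx hxs ht))
      (fun t _ => by
        have h1 := ((hasDerivAt_id t).mul_const (inner ℝ (hessian f x s) s : ℝ)).add
          ((((hasDerivAt_id t).pow 2).const_mul (M / 2)).mul_const (‖s‖ ^ 3))
        refine h1.congr_deriv ?_
        simp [-mul_eq_mul_right_iff]
        ring)
      (fun t ht => by
        have h1 := h.hessian_lipschitz _ (h.add_smul_mem hx hxs ht) _ hx
        rw [add_sub_cancel_left, norm_smul, Real.norm_of_nonneg ht.1] at h1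
        have h2 := real_inner_le_norm ((hessian f (x + t • s) - hessian f x) s) s
        have h3 := (hessian f (x + t • s) - hessian f x).le_opNorm s
        rw [sub_apply, inner_sub_left] at h2
        rw [sub_apply] at h3
        have h4 : ‖(hessian f (x + t • s)) s - (hessian f x) s‖ * ‖s‖
            ≤ M * (t * ‖s‖) * ‖s‖ * ‖s‖ := by
          gcongr
          exact h3.trans (by gcongr)
        nlinarith [norm_nonneg s])
      ht
    simp only [zero_smul, add_zero] at key
    linarith
  have key := sub_le_sub_of_hasDerivAt_le (t := 1)
    (g := fun t => t * inner ℝ (gradient f x) s + t ^ 2 * (1 / 2 * inner ℝ (hessian f x s) s)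
      + t ^ 3 * (M / 6 * ‖s‖ ^ 3))
    (fun t ht => h.hasDerivAt_line (h.add_smul_mem hx hxs ht))
    (fun t _ => (((hasDerivAt_id t).mul_const (inner ℝ (gradient f x) s : ℝ)).add
        (((hasDerivAt_id t).pow 2).mul_const (1 / 2 * inner ℝ (hessian f x s) s))).add
        (((hasDerivAt_id t).pow 3).mul_const (M / 6 * ‖s‖ ^ 3)))
    (fun t ht => by
      refine (hgrad t ht).trans (le_of_eq ?_)
      simp
      ring)
    (Set.right_mem_Icc.2 zero_le_one)
  simp only [one_smul, zero_smul, add_zero] at key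
  linarith

/-- A step along a relatively accurate gradient decreases the function. -/
lemma SmoothObjective.gradient_step_le (h : SmoothObjective S f L M fbar) (hL : 0 < L)
    {x g : Vec d} (hx : x ∈ S) (hx' : x - (1 / L) • g ∈ S)
    (hg : ‖g - gradient f x‖ ≤ 1 / 3 * ‖g‖) :
    f (x - (1 / L) • g) ≤ f x - ‖g‖ ^ 2 / (6 * L) := by
  rw [sub_eq_add_neg] at hx' ⊢
  have h1 := h.le_quadratic hx hx'
  rw [norm_neg, norm_smul, inner_neg_right, inner_smul_right,
    Real.norm_of_nonneg (by positivity)] at h1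
  have h2 := real_inner_le_norm (g - gradient f x) g
  rw [inner_sub_left, real_inner_self_eq_norm_sq] at h2
  -- The relative error costs a third of ‖g‖² and the quadratic term costs half of it, which leaves
  -- 2/3 - 1/2 = 1/6.
  have h3 : 2 / 3 * ‖g‖ ^ 2 ≤ inner ℝ (gradient f x) g := by nlinarith [norm_nonneg g]
  have h4 : 1 / L * (2 / 3 * ‖g‖ ^ 2) ≤ 1 / L * inner ℝ (gradient f x) g := by gcongr
  have h5 : L / 2 * (1 / L * ‖g‖) ^ 2 = 1 / L * (1 / 2 * ‖g‖ ^ 2) := by field_simp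
  have h6 : ‖g‖ ^ 2 / (6 * L) = 1 / L * (1 / 6 * ‖g‖ ^ 2) := by field_simp
  rw [h5] at h1
  rw [h6]
  linarith

/-- A step along a direction of sufficiently negative curvature decreases the function, up to
the first order term. -/
lemma SmoothObjective.curvature_step_le (h : SmoothObjective S f L M fbar) (hM : 0 < M)
    {x p : Vec d} {H : Vec d →L[ℝ] Vec d} {e a s : ℝ} (hx : x ∈ S)
    (hx' : x + (2 * a / M * s) • p ∈ S) (hs : s = 1 ∨ s = -1) (hp : ‖p‖ = 1)
    (he : 0 < e) (hea : e ≤ a) (hH : ‖H - hessian f x‖ ≤ 2 / 9 * e)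
    (hcurv : inner ℝ p (H p) ≤ -a) :
    f (x + (2 * a / M * s) • p) ≤ f x - 2 * a ^ 3 / (9 * M ^ 2)
      + 2 * a / M * inner ℝ p (gradient f x) * s := by
  have ha : 0 < a := he.trans_le hea
  have h1 := h.le_cubic hx hx'
  have hs2 : s ^ 2 = 1 := by rcases hs with rfl | rfl <;> norm_num
  have hs1 : |s| = 1 := by rcases hs with rfl | rfl <;> norm_num
  have hnorm : ‖(2 * a / M * s) • p‖ = 2 * a / M := by
    rw [norm_smul, hp, Real.norm_eq_abs, abs_mul, hs1, abs_of_pos (by positivity)]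
    ring
  have h2 := real_inner_le_norm p ((hessian f x - H) p)
  have h3 := (hessian f x - H).le_opNorm p
  rw [norm_sub_rev] at hH
  rw [hp] at h2 h3
  rw [sub_apply, inner_sub_right] at h2
  rw [sub_apply] at h3
  -- The Hessian error is at most 2e/9 ≤ 2a/9.
  have h4 : inner ℝ p (hessian f x p) ≤ -(7 / 9) * a := by linarith
  rw [hnorm, map_smul, inner_smul_right, inner_smul_left, inner_smul_right, real_inner_comm,
    real_inner_comm p] at h1
  simp only [conj_trivial] at h1
  have h5 : (2 * a / M) ^ 2 * inner ℝ p (hessian f x p) ≤ (2 * a / M) ^ 2 * (-(7 / 9) * a) := by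
    gcongr
  -- The sign squares away in the second order term, so it survives only in the first order one.
  have h6 : 1 / 2 * (2 * a / M * s * (2 * a / M * s * inner ℝ p (hessian f x p)))
      = 1 / 2 * ((2 * a / M) ^ 2 * inner ℝ p (hessian f x p)) := by
    linear_combination (1 / 2 * ((2 * a / M) ^ 2 * inner ℝ p (hessian f x p))) * hs2
  -- In units of a³/M²: -14/9 from the curvature plus 4/3 from the cubic remainder.
  have h7 : 1 / 2 * ((2 * a / M) ^ 2 * (-(7 / 9) * a)) + M / 6 * (2 * a / M) ^ 3
      = - (2 * a ^ 3 / (9 * M ^ 2)) := by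
    field_simp
    ring
  rw [h6] at h1
  linarith

end Taylor

/-! ### Azuma's inequality for predictable multiples of fair signs -/

section Azuma

variable {Ω : Type*} [mΩ : MeasurableSpace Ω] {μ : Measure Ω}
  {ℱ : Filtration ℕ mΩ} {σ : ℕ → Ω → ℝ} {u : ℕ → Ω → ℝ}

/-- Partial sums of predictable multiples of fair signs are adapted. -/
lemma FairSigns.measurable_sum (hσ : FairSigns μ ℱ σ) (hu : ∀ k, Measurable[ℱ k] (u k)) (n : ℕ) :
    Measurable[ℱ n] (fun ω => ∑ k ∈ Finset.range n, u k ω * σ k ω) := by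
  refine Finset.measurable_fun_sum _ fun k hk => ?_
  have hk' := Finset.mem_range.1 hk
  exact ((hu k).mono (ℱ.mono hk'.le) le_rfl).mul ((hσ.measurable k).mono (ℱ.mono hk') le_rfl)

/-- A fair sign can be averaged out against what is known before it is drawn. -/
lemma FairSigns.lintegral_mul_exp [IsProbabilityMeasure μ] (hσ : FairSigns μ ℱ σ)
    {k : ℕ} {F : Ω → ENNReal} {v : Ω → ℝ}
    (hF : Measurable[ℱ k] F) (hv : Measurable[ℱ k] v) :
    ∫⁻ ω, F ω * ENNReal.ofReal (Real.exp (v ω * σ k ω)) ∂μ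
      = ∫⁻ ω, F ω * ENNReal.ofReal (Real.cosh (v ω)) ∂μ := by
  have hmeas : Measurable (σ k) := (hσ.measurable k).mono (ℱ.le _) le_rfl
  have hle : MeasurableSpace.comap (σ k) inferInstance ≤ mΩ := hmeas.comap_le
  -- On each value of the sign the integrand is a factor known at time k times the indicator of an
  -- independent event of probability 1/2. The two halves recombine to cosh.
  have hsplit : ∀ ω, F ω * ENNReal.ofReal (Real.exp (v ω * σ k ω)) =
      F ω * ENNReal.ofReal (Real.exp (v ω)) * (σ k ⁻¹' {1}).indicator (fun _ => 1) ω
      + F ω * ENNReal.ofReal (Real.exp (-v ω)) * (σ k ⁻¹' {-1}).indicator (fun _ => 1) ω := by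
    intro ω
    rcases hσ.values k ω with h | h <;> norm_num [Set.indicator, h]
  have hside : ∀ (s : ℝ) (w : Ω → ℝ), Measurable[ℱ k] w → μ (σ k ⁻¹' {s}) = 1 / 2 →
      ∫⁻ ω, F ω * ENNReal.ofReal (Real.exp (w ω)) * (σ k ⁻¹' {s}).indicator (fun _ => 1) ω ∂μ
        = (∫⁻ ω, F ω * ENNReal.ofReal (Real.exp (w ω)) ∂μ) * (1 / 2) := by
    intro s w hw hs
    have hset : MeasurableSet[MeasurableSpace.comap (σ k) inferInstance] (σ k ⁻¹' {s}) :=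
      ⟨{s}, measurableSet_singleton s, rfl⟩
    have hG : Measurable[ℱ k] fun ω => F ω * ENNReal.ofReal (Real.exp (w ω)) :=
      hF.mul (ENNReal.measurable_ofReal.comp (Real.measurable_exp.comp hw))
    rw [lintegral_mul_eq_lintegral_mul_lintegral_of_independent_measurableSpace (ℱ.le k) hle
      (hσ.indep k) hG (measurable_const.indicator hset), lintegral_indicator (hle _ hset)]
    simp [hs]
  have hM : ∀ w : Ω → ℝ, Measurable[ℱ k] w →
      Measurable fun ω => F ω * ENNReal.ofReal (Real.exp (w ω)) := fun w hw =>
    (hF.mul (ENNReal.measurable_ofReal.comp (Real.measurable_exp.comp hw))).mono (ℱ.le k) le_rfl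
  have hneg : Measurable[ℱ k] fun ω => -v ω := hv.neg
  simp_rw [hsplit]
  have hleft : Measurable fun ω =>
      F ω * ENNReal.ofReal (Real.exp (v ω)) * (σ k ⁻¹' {1}).indicator (fun _ => 1) ω :=
    (hM v hv).mul (measurable_const.indicator (hmeas (measurableSet_singleton _)))
  have hsum : Measurable fun ω =>
      F ω * ENNReal.ofReal (Real.exp (v ω)) + F ω * ENNReal.ofReal (Real.exp (-v ω)) :=
    (hM v hv).add (hM _ hneg)
  rw [lintegral_add_left hleft,
    hside 1 v hv (hσ.prob_pos k), hside (-1) (fun ω => -v ω) hneg (hσ.prob_neg k), ← add_mul,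
    ← lintegral_add_left (hM v hv), ← lintegral_mul_const _ hsum]
  refine lintegral_congr fun ω => ?_
  rw [← mul_add, mul_assoc, ← ENNReal.ofReal_add (Real.exp_pos _).le (Real.exp_pos _).le,
    Real.cosh_eq, ENNReal.ofReal_div_of_pos two_pos]
  simp [div_eq_mul_inv]

/-- The exponential moments of a sum of bounded predictable multiples of fair signs. -/
lemma FairSigns.lintegral_exp_sum_le [IsProbabilityMeasure μ] (hσ : FairSigns μ ℱ σ)
    (hu : ∀ k, Measurable[ℱ k] (u k))
    {b : ℝ} (hb : ∀ k ω, |u k ω| ≤ b) (t : ℝ) (n : ℕ) :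
    ∫⁻ ω, ENNReal.ofReal (Real.exp (t * ∑ k ∈ Finset.range n, u k ω * σ k ω)) ∂μ
      ≤ ENNReal.ofReal (Real.exp (n * ((t * b) ^ 2 / 2))) := by
  induction n with
  | zero => simp
  | succ n ih =>
    have hF : Measurable[ℱ n] fun ω =>
        ENNReal.ofReal (Real.exp (t * ∑ k ∈ Finset.range n, u k ω * σ k ω)) :=
      ENNReal.measurable_ofReal.comp
        (Real.measurable_exp.comp ((hσ.measurable_sum hu n).const_mul t))
    calc ∫⁻ ω, ENNReal.ofReal (Real.exp (t * ∑ k ∈ Finset.range (n + 1), u k ω * σ k ω)) ∂μ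
        = ∫⁻ ω, ENNReal.ofReal (Real.exp (t * ∑ k ∈ Finset.range n, u k ω * σ k ω))
            * ENNReal.ofReal (Real.exp (t * u n ω * σ n ω)) ∂μ := by
          refine lintegral_congr fun ω => ?_
          rw [← ENNReal.ofReal_mul (Real.exp_pos _).le, ← Real.exp_add, Finset.sum_range_succ]
          ring_nf
      _ = ∫⁻ ω, ENNReal.ofReal (Real.exp (t * ∑ k ∈ Finset.range n, u k ω * σ k ω))
            * ENNReal.ofReal (Real.cosh (t * u n ω)) ∂μ :=
          hσ.lintegral_mul_exp hF ((hu n).const_mul t)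
      _ ≤ ∫⁻ ω, ENNReal.ofReal (Real.exp (t * ∑ k ∈ Finset.range n, u k ω * σ k ω))
            * ENNReal.ofReal (Real.exp ((t * b) ^ 2 / 2)) ∂μ := by
          refine lintegral_mono fun ω => ?_
          gcongr
          refine (Real.cosh_le_exp_half_sq _).trans (Real.exp_le_exp.2 ?_)
          rw [mul_pow, mul_pow]
          gcongr ?_ * ?_ / 2
          exact sq_le_sq' (abs_le.1 (hb n ω)).1 (abs_le.1 (hb n ω)).2
      _ ≤ ENNReal.ofReal (Real.exp (n * ((t * b) ^ 2 / 2)))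
            * ENNReal.ofReal (Real.exp ((t * b) ^ 2 / 2)) := by
          rw [lintegral_mul_const _ (hF.mono (ℱ.le n) le_rfl)]
          gcongr
      _ = _ := by
          rw [← ENNReal.ofReal_mul (Real.exp_pos _).le, ← Real.exp_add]
          push_cast
          ring_nf

/-- The Azuma inequality for bounded predictable multiples of fair signs. -/
lemma FairSigns.measure_sum_ge_le [IsProbabilityMeasure μ] (hσ : FairSigns μ ℱ σ)
    (hu : ∀ k, Measurable[ℱ k] (u k))
    {b : ℝ} (hb0 : 0 < b) (hb : ∀ k ω, |u k ω| ≤ b) {c : ℝ} (hc : 0 ≤ c) (n : ℕ) :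
    μ.real {ω | c * n ≤ ∑ k ∈ Finset.range n, u k ω * σ k ω}
      ≤ Real.exp (-(c ^ 2 * n / (2 * b ^ 2))) := by
  -- The minimiser of -t c n + n t² b² / 2, the exponent in the Chernoff bound.
  set t : ℝ := c / b ^ 2 with ht
  have ht0 : 0 ≤ t := by positivity
  have hmeas : Measurable fun ω =>
      ENNReal.ofReal (Real.exp (t * ∑ k ∈ Finset.range n, u k ω * σ k ω)) :=
    (ENNReal.measurable_ofReal.comp
      (Real.measurable_exp.comp ((hσ.measurable_sum hu n).const_mul t))).mono (ℱ.le n) le_rfl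
  have h1 := mul_meas_ge_le_lintegral (μ := μ) hmeas (ENNReal.ofReal (Real.exp (t * (c * n))))
  have h2 := h1.trans (hσ.lintegral_exp_sum_le hu hb t n)
  have hsub : μ {ω | c * n ≤ ∑ k ∈ Finset.range n, u k ω * σ k ω} ≤
      μ {ω | ENNReal.ofReal (Real.exp (t * (c * n))) ≤
        ENNReal.ofReal (Real.exp (t * ∑ k ∈ Finset.range n, u k ω * σ k ω))} := by
    refine measure_mono fun ω hω => ?_
    simp only [Set.mem_ofPred_eq] at hω ⊢
    gcongr
  have h3 : ENNReal.ofReal (Real.exp (t * (c * n)))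
      * μ {ω | c * n ≤ ∑ k ∈ Finset.range n, u k ω * σ k ω}
      ≤ ENNReal.ofReal (Real.exp (n * ((t * b) ^ 2 / 2))) := le_trans (by gcongr) h2
  have h4 := ENNReal.toReal_mono ENNReal.ofReal_ne_top h3
  rw [ENNReal.toReal_mul, ENNReal.toReal_ofReal (Real.exp_pos _).le,
    ENNReal.toReal_ofReal (Real.exp_pos _).le, mul_comm,
    ← le_div_iff₀ (Real.exp_pos _), ← Real.exp_sub] at h4
  refine h4.trans (le_of_eq ?_)
  congr 1
  rw [ht]
  field_simp
  ring

end Azuma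

/-! ### Descent along the run and the termination probability -/

section Run

variable {d : ℕ} {S : Set (Vec d)} {f : Vec d → ℝ} {L M fbar : ℝ}

/-- Regularity of the gradient is known only on S; extending it by zero gives a globally measurable
function, so the noise is adapted even where the iterates leave S after termination. -/
lemma SmoothObjective.measurable_indicator_gradient (h : SmoothObjective S f L M fbar) :
    Measurable (S.indicator (gradient f)) := by
  have hc : ContinuousOn (gradient f) S := fun x hx =>
    (h.gradient_differentiable x hx).continuousAt.continuousWithinAt
  classical
  have := hc.measurable_piecewise (g := 0) continuousOn_const h.isOpen.measurableSet
  rwa [Set.piecewise_eq_indicator] at this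

lemma measurable_curv {Ω : Type*} {m : MeasurableSpace Ω} {r : Ω → Reply d}
    (hhess : Measurable fun ω => (r ω).hess) (hdir : Measurable fun ω => (r ω).dir) :
    Measurable fun ω => (r ω).curv := by
  have hc : Continuous fun p : (Vec d →L[ℝ] Vec d) × Vec d => p.1 p.2 := by fun_prop
  exact hdir.inner (hc.measurable.comp (hhess.prodMk hdir))

lemma measurable_nextIterate {Ω : Type*} {m : MeasurableSpace Ω} {εg εH : ℝ} {x : Ω → Vec d}
    {r : Ω → Reply d} {s : Ω → ℝ} (hx : Measurable x) (hgrad : Measurable fun ω => (r ω).grad)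
    (hhess : Measurable fun ω => (r ω).hess) (hdir : Measurable fun ω => (r ω).dir)
    (hstep : Measurable fun ω => (r ω).step) (hs : Measurable s) :
    Measurable fun ω => nextIterate L M εg εH (x ω) (r ω) (s ω) := by
  unfold nextIterate
  refine Measurable.ite (measurableSet_lt measurable_const hgrad.norm)
    (hx.sub (hgrad.const_smul (1 / L))) (Measurable.ite
      (measurableSet_lt (measurable_curv hhess hdir) measurable_const) ?_ hx)
  exact hx.add (((((hstep.const_mul 2).div_const M).mul hs)).smul hdir)

variable {Ω : Type*} [mΩ : MeasurableSpace Ω] {μ : Measure Ω} {ℱ : Filtration ℕ mΩ}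
  {σ : ℕ → Ω → ℝ} {r : ℕ → Ω → Reply d} {εg εH : ℝ} {x₀ : Vec d}

/-- The iterates are determined by the information available before the next coin flip. -/
lemma measurable_iterate (hσ : FairSigns μ ℱ σ) (hr : AdaptedReplies ℱ r) (k : ℕ) :
    Measurable[ℱ k] (iterate L M εg εH x₀ r σ k) := by
  induction k with
  | zero => exact measurable_const
  | succ k ih =>
    have hle : ℱ k ≤ ℱ (k + 1) := ℱ.mono k.le_succ
    exact measurable_nextIterate (m := ℱ (k + 1)) (ih.mono hle le_rfl) ((hr.grad k).mono hle le_rfl)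
      ((hr.hess k).mono hle le_rfl) ((hr.dir k).mono hle le_rfl) ((hr.step k).mono hle le_rfl)
      (hσ.measurable k)

/-- The coefficient of the sign in the change of the objective at iteration `k`: the first order
term of a negative curvature step, truncated at `b`. -/
noncomputable def noise (S : Set (Vec d)) (f : Vec d → ℝ) (L M εg εH b : ℝ) (x₀ : Vec d)
    (r : ℕ → Ω → Reply d) (σ : ℕ → Ω → ℝ) (k : ℕ) (ω : Ω) : ℝ :=
  if εg < ‖(r k ω).grad‖ then 0
  else max (-b) (min b (2 * (r k ω).step / M *
    inner ℝ (r k ω).dir (S.indicator (gradient f) (iterate L M εg εH x₀ r σ k ω))))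

/-- Azuma requires a bound at every k and ω, whereas the accuracy conditions hold only at iterations
that take place. The truncation supplies the bound everywhere and is inactive at the curvature steps
of the run. -/
lemma abs_noise_le {Ω : Type*} {σ : ℕ → Ω → ℝ} {r : ℕ → Ω → Reply d}
    {b : ℝ} (hb : 0 ≤ b) (k : ℕ) (ω : Ω) :
    |noise S f L M εg εH b x₀ r σ k ω| ≤ b := by
  unfold noise
  split_ifs
  · simpa using hb
  · exact abs_le.2 ⟨le_max_left _ _, max_le (by linarith) (min_le_left _ _)⟩

lemma SmoothObjective.measurable_noise (h : SmoothObjective S f L M fbar)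
    (hσ : FairSigns μ ℱ σ) (hr : AdaptedReplies ℱ r) (b : ℝ) (k : ℕ) :
    Measurable[ℱ k] (noise S f L M εg εH b x₀ r σ k) := by
  have hx := measurable_iterate (L := L) (M := M) (εg := εg) (εH := εH) (x₀ := x₀) hσ hr k
  have hgrad := hr.grad k
  have hdir := hr.dir k
  have hstep := hr.step k
  let := ℱ k
  refine Measurable.ite (measurableSet_lt measurable_const hgrad.norm) measurable_const ?_
  exact measurable_const.max (measurable_const.min (((hstep.const_mul 2).div_const M).mul
    (hdir.inner (h.measurable_indicator_gradient.comp hx))))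

/-- One iteration that does not stop decreases the objective, up to the noise. -/
lemma ValidRun.objective_succ_le (hrun : ValidRun S f L M εg εH εH x₀ r σ)
    (h : SmoothObjective S f L M fbar) (hL : 0 < L) (hM : 0 < M) (hεg : 0 < εg) (hεH : 0 < εH)
    (hσ : FairSigns μ ℱ σ) {k : ℕ} {ω : Ω} (hk : Reached εg εH r (k + 1) ω) :
    f (iterate L M εg εH x₀ r σ (k + 1) ω) ≤ f (iterate L M εg εH x₀ r σ k ω)
      - decrease L M εg εH
      + noise S f L M εg εH (8 * εH * εg / (3 * M)) x₀ r σ k ω * σ k ω := by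
  have hk0 : Reached εg εH r k ω := fun j hj => hk j (hj.trans k.lt_succ_self)
  have hns := hk k k.lt_succ_self
  have hx := hrun.mem k ω hk0
  have hx' := hrun.mem (k + 1) ω hk
  have hacc := hrun.gradient k ω hk0
  rw [AccurateGradient] at hacc
  simp only [iterate, nextIterate] at hx' ⊢
  unfold noise
  by_cases hg : εg < ‖(r k ω).grad‖
  · simp only [hg, if_true] at hx' ⊢
    rw [max_eq_right hg.le] at hacc
    have h1 := h.gradient_step_le hL hx hx' hacc
    have h2 : decrease L M εg εH ≤ ‖(r k ω).grad‖ ^ 2 / (6 * L) :=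
      (min_le_left _ _).trans (by gcongr)
    linarith
  · have hcurv : (r k ω).curv < -εH := by
      by_contra hc
      exact hns ⟨hg, hc⟩
    simp only [hg, if_false, hcurv, if_true] at hx' ⊢
    rw [not_lt] at hg
    rw [max_eq_left hg] at hacc
    have hstep := hrun.step k ω hk0 hg hcurv
    -- With α = ε_H the admissible interval of stepsizes collapses to a point.
    have ha : (r k ω).step = εH := le_antisymm (hstep.2.trans (min_le_left _ _)) hstep.1
    have hp := (hrun.eigenvector k ω hk0 hg).1
    rw [ha] at hx' ⊢
    have h1 := h.curvature_step_le hM hx hx' (hσ.values k ω) hp hεH le_rfl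
      (hrun.hessian k ω hk0 hg).2 (le_of_lt hcurv)
    have h2 : decrease L M εg εH ≤ 2 * εH ^ 3 / (9 * M ^ 2) := min_le_right _ _
    have h3 := abs_real_inner_le_norm (r k ω).dir
      (_root_.gradient f (iterate L M εg εH x₀ r σ k ω))
    rw [hp, one_mul] at h3
    have h4 := norm_le_norm_add_norm_sub' (_root_.gradient f (iterate L M εg εH x₀ r σ k ω))
      (r k ω).grad
    rw [norm_sub_rev] at h4
    -- No gradient step was taken, so ‖∇f‖ ≤ ε_g + ε_g/3, and the truncation at b has no effect.
    have h5 : |2 * εH / M * inner ℝ (r k ω).dir (_root_.gradient f (iterate L M εg εH x₀ r σ k ω))|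
        ≤ 8 * εH * εg / (3 * M) := by
      rw [abs_mul, abs_of_pos (by positivity)]
      calc _ ≤ 2 * εH / M * (4 / 3 * εg) := by gcongr; linarith
        _ = _ := by field_simp; ring
    rw [Set.indicator_of_mem hx, min_eq_right (abs_le.1 h5).2, max_eq_right (abs_le.1 h5).1]
    linarith

/-- The total decrease along the run, up to the accumulated noise. -/
lemma ValidRun.objective_le (hrun : ValidRun S f L M εg εH εH x₀ r σ)
    (h : SmoothObjective S f L M fbar) (hL : 0 < L) (hM : 0 < M) (hεg : 0 < εg) (hεH : 0 < εH)
    (hσ : FairSigns μ ℱ σ) {n : ℕ} {ω : Ω} (hn : Reached εg εH r n ω) :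
    f (iterate L M εg εH x₀ r σ n ω) ≤ f x₀ - n * decrease L M εg εH
      + ∑ k ∈ Finset.range n,
        noise S f L M εg εH (8 * εH * εg / (3 * M)) x₀ r σ k ω * σ k ω := by
  induction n with
  | zero => simp [iterate]
  | succ n ih =>
    have h1 := ih fun j hj => hn j (hj.trans n.lt_succ_self)
    have h2 := hrun.objective_succ_le h hL hM hεg hεH hσ hn
    rw [Finset.sum_range_succ]
    push_cast
    linarith

lemma decrease_pos (hL : 0 < L) (hM : 0 < M) (hεg : 0 < εg) (hεH : 0 < εH) :
    0 < decrease L M εg εH := lt_min (by positivity) (by positivity)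

lemma one_le_constB (hL : 0 < L) (hM : 0 < M) (hεg : 0 < εg) (hεH : 0 < εH) :
    1 ≤ constB L M εH εg := le_add_of_nonneg_right (by positivity)

/-- K is at least its first entry, which is nonnegative, and B ≥ 1. This lower bound on n is all
that the probability estimate uses. -/
lemma add_le_iterBound (hL : 0 < L) (hM : 0 < M) (hεg : 0 < εg) (hεH : 0 < εH) {δ : ℝ}
    (hδ : 0 < δ) (hδ1 : δ < 1) (Δ : ℝ) (η : ℕ) :
    2 * (Δ / decrease L M εg εH) + constC M εH εg εH * Real.log (1 / δ)
      ≤ iterBound L M εH εg εH Δ δ η := by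
  have h1 : constC M εH εg εH * Real.log (1 / δ) ≤ constK L M εH εg εH Δ δ η := le_max_left _ _
  have h2 : 0 ≤ Real.log (1 / δ) := Real.log_nonneg (one_le_one_div hδ hδ1.le)
  have h3 : 0 ≤ constC M εH εg εH * Real.log (1 / δ) := mul_nonneg (by unfold constC; positivity) h2
  unfold iterBound
  nlinarith [one_le_constB hL hM hεg hεH]

/-- If the two terms of `C_ε` agree, the algorithm with `α = ε_H` terminates within the iteration
bound with probability at least `1 - δ`. -/
lemma ValidRun.le_measure_terminatesWithin [IsProbabilityMeasure μ]
    (hrun : ValidRun S f L M εg εH εH x₀ r σ)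
    (h : SmoothObjective S f L M fbar) (hL : 0 < L) (hM : 0 < M) (hεg : 0 < εg) (hεH : 0 < εH)
    (hcoupling : εg ^ 2 / (6 * L) = 2 * εH ^ 3 / (9 * M ^ 2))
    (hσ : FairSigns μ ℱ σ) (hr : AdaptedReplies ℱ r) {δ : ℝ} (hδ : 0 < δ) (hδ1 : δ < 1) (η : ℕ) :
    1 - δ ≤ μ.real {ω | TerminatesWithin εg εH r
      (iterBound L M εH εg εH (f x₀ - fbar) δ η) ω} := by
  set Δ := f x₀ - fbar with hΔdef
  set c := decrease L M εg εH with hcdef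
  set b := 8 * εH * εg / (3 * M) with hbdef
  set n := iterBound L M εH εg εH Δ δ η with hndef
  -- The first integer above n: not terminating within n means exactly that iteration T is reached.
  set T := ⌊n⌋₊ + 1 with hT
  have hc : 0 < c := decrease_pos hL hM hεg hεH
  have hceq : c = 2 * εH ^ 3 / (9 * M ^ 2) := by rw [hcdef, decrease, hcoupling, min_self]
  have hb : 0 < b := by positivity
  have hlog : 0 ≤ Real.log (1 / δ) := Real.log_nonneg (one_le_one_div hδ hδ1.le)
  have hC : 0 < constC M εH εg εH := by unfold constC; positivity
  have hΔ : 0 ≤ Δ := by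
    -- The validity of a run places x₀ in S only through a sample point.
    obtain ⟨ω⟩ : Nonempty Ω := μ.nonempty_of_neZero
    have h0 := h.bounded_below _ (hrun.mem 0 ω fun j hj => absurd hj (Nat.not_lt_zero j))
    exact sub_nonneg.2 h0
  have hn := add_le_iterBound hL hM hεg hεH hδ hδ1 Δ η
  rw [← hcdef, ← hndef] at hn
  have hn0 : 0 ≤ n := le_trans (by positivity) hn
  have hTn : n < T := by
    rw [hT]
    push_cast
    exact Nat.lt_floor_add_one n
  have hmeas := fun k => h.measurable_noise (εg := εg) (εH := εH) (x₀ := x₀) hσ hr b k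
  set A := {ω | c / 2 * T ≤
    ∑ k ∈ Finset.range T, noise S f L M εg εH b x₀ r σ k ω * σ k ω} with hA
  have hAmeas : MeasurableSet A :=
    measurableSet_le measurable_const ((hσ.measurable_sum hmeas T).mono (ℱ.le T) le_rfl)
  have hAle : μ.real A ≤ δ := by
    refine (hσ.measure_sum_ge_le hmeas hb (abs_noise_le hb.le) (half_pos hc).le T).trans ?_
    rw [← Real.le_log_iff_exp_le hδ, neg_le, ← Real.log_inv, ← one_div]
    -- The coupling identifies c with the curvature term of C_ε, so the exponent is exactly 2T/C. As
    -- T ≥ C log(1/δ), the bound is in fact δ².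
    have h1 : (c / 2) ^ 2 * T / (2 * b ^ 2) = 2 * (T / constC M εH εg εH) := by
      rw [hceq, hbdef, constC]
      field_simp
      ring
    rw [h1]
    have h2 : Real.log (1 / δ) ≤ T / constC M εH εg εH := by
      rw [le_div_iff₀ hC, mul_comm]
      have : 0 ≤ 2 * (Δ / c) := by positivity
      linarith
    linarith
  have hsub : Aᶜ ⊆ {ω | TerminatesWithin εg εH r n ω} := by
    intro ω hω
    by_contra hnt
    refine hω ?_
    have hreach : Reached εg εH r T ω := fun j hj hs =>
      hnt ⟨j, (Nat.cast_le.2 (Nat.lt_succ_iff.1 hj)).trans (Nat.floor_le hn0), hs⟩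
    -- Together with f̄ ≤ f(x_T), this makes the noise at least Tc - Δ, hence at least Tc/2 because
    -- 2Δ ≤ Tc.
    have h1 := hrun.objective_le h hL hM hεg hεH hσ hreach
    have h2 := h.bounded_below _ (hrun.mem T ω hreach)
    have h3 : 2 * (Δ / c) ≤ T := by
      have : 0 ≤ constC M εH εg εH * Real.log (1 / δ) := by positivity
      linarith
    have h4 : 2 * Δ ≤ T * c := by
      rw [← mul_div_assoc] at h3
      exact (div_le_iff₀ hc).1 h3
    rw [hA, Set.mem_ofPred_eq]
    linarith
  calc 1 - δ ≤ 1 - μ.real A := by linarith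
    _ = μ.real Aᶜ := (probReal_compl_eq_one_sub hAmeas).symm
    _ ≤ _ := measureReal_mono hsub

end Run

/-! ### Orders of magnitude in y = ε^(1/3) -/

section Asymptotics

variable {L M : ℝ}

/-- The constant in `ε_H = κ ε^(2/3)`. -/
noncomputable def couplingConst (L M : ℝ) : ℝ := (3 * M ^ 2 / (4 * L)) ^ (1 / 3 : ℝ)

lemma couplingConst_pos (hL : 0 < L) (hM : 0 < M) : 0 < couplingConst L M :=
  Real.rpow_pos_of_pos (by positivity) _

lemma couplingConst_pow_three (hL : 0 < L) (hM : 0 < M) :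
    couplingConst L M ^ 3 = 3 * M ^ 2 / (4 * L) := by
  rw [couplingConst, ← Real.rpow_natCast, ← Real.rpow_mul (by positivity)]
  norm_num

lemma rpow_third_pow_three {ε : ℝ} (hε : 0 < ε) : (ε ^ (1 / 3 : ℝ)) ^ 3 = ε := by
  rw [← Real.rpow_natCast, ← Real.rpow_mul hε.le]
  norm_num

lemma rpow_two_thirds {ε : ℝ} (hε : 0 < ε) : ε ^ (2 / 3 : ℝ) = (ε ^ (1 / 3 : ℝ)) ^ 2 := by
  rw [← Real.rpow_natCast, ← Real.rpow_mul hε.le]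
  norm_num

/-- The coupling says e³ = κ³ y⁶, and cubing is injective on nonnegative reals. -/
lemma eq_couplingConst_mul (hL : 0 < L) (hM : 0 < M) {y e : ℝ} (hy : 0 < y) (he : 0 < e)
    (h : (y ^ 3) ^ 2 / (6 * L) = 2 * e ^ 3 / (9 * M ^ 2)) : e = couplingConst L M * y ^ 2 := by
  have hκ := couplingConst_pos hL hM
  rw [← pow_left_inj₀ he.le (by positivity) (three_ne_zero), mul_pow,
    couplingConst_pow_three hL hM]
  field_simp at h ⊢
  linarith

/-- Substitution gives 2304 M² / (κ⁴ y²), and M² = 4Lκ³/3 removes M. -/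
lemma constC_eq (hL : 0 < L) (hM : 0 < M) {y : ℝ} (hy : 0 < y) :
    constC M (couplingConst L M * y ^ 2) (y ^ 3) (couplingConst L M * y ^ 2)
      = 3072 * L / couplingConst L M / y ^ 2 := by
  have hκ := couplingConst_pos hL hM
  have hκ3 := couplingConst_pow_three hL hM
  rw [eq_div_iff (by positivity)] at hκ3
  unfold constC
  field_simp
  linear_combination (-768) * hκ3

lemma constB_eq (hM : 0 < M) {y : ℝ} (hy : 0 < y) :
    constB L M (couplingConst L M * y ^ 2) (y ^ 3)
      = 1 + 18 * couplingConst L M * L / M / y := by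
  unfold constB
  field_simp

lemma constB_le (hM : 0 < M) {y : ℝ} (hy : 0 < y) (hy1 : y ≤ 1) :
    constB L M (couplingConst L M * y ^ 2) (y ^ 3)
      ≤ (1 + 18 * couplingConst L M * L / M) / y := by
  rw [constB_eq hM hy, add_div]
  gcongr
  exact one_le_one_div hy hy1

lemma decrease_eq (hL : 0 < L) (hM : 0 < M) {y : ℝ} (hy : 0 < y) :
    decrease L M (y ^ 3) (couplingConst L M * y ^ 2) = y ^ 6 / (6 * L) := by
  have hκ3 := couplingConst_pow_three hL hM
  have h : 2 * (couplingConst L M * y ^ 2) ^ 3 / (9 * M ^ 2) = (y ^ 3) ^ 2 / (6 * L) := by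
    rw [mul_pow, hκ3]
    field_simp
    ring
  rw [decrease, h, min_self]
  ring

/-- Lets the √Δ in K be absorbed into the linear factor 1 + Δ + log(1/δ). -/
lemma sqrt_le_one_add {x : ℝ} (hx : 0 ≤ x) : √x ≤ 1 + x := by
  rw [Real.sqrt_le_left (by positivity)]
  nlinarith

/-- The iteration bound for `η = 2`, coupled accuracies and `y = ε^(1/3) ≤ 1`. -/
lemma iterBound_le (hL : 0 < L) (hM : 0 < M) {y : ℝ} (hy : 0 < y) (hy1 : y ≤ 1) {Δ δ : ℝ}
    (hΔ : 0 ≤ Δ) (hδ : 0 < δ) (hδ1 : δ < 1) :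
    iterBound L M (couplingConst L M * y ^ 2) (y ^ 3) (couplingConst L M * y ^ 2) Δ δ 2 ≤
      (12 * L + (1 + 18 * couplingConst L M * L / M) * (3072 * L / couplingConst L M) *
        (1 + 8 * √(6 * L) + 16 * (3072 * L / couplingConst L M) *
          (1 + 18 * couplingConst L M * L / M))) *
      (1 + Δ + Real.log (1 / δ)) / y ^ 6 := by
  have hκ := couplingConst_pos hL hM
  have hBle := constB_le (L := L) hM hy hy1
  have hB0 : 0 ≤ constB L M (couplingConst L M * y ^ 2) (y ^ 3) := by
    rw [constB_eq hM hy]; positivity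
  unfold iterBound constK
  rw [constC_eq hL hM hy, decrease_eq hL hM hy]
  set D := 1 + 18 * couplingConst L M * L / M with hD
  set A := 3072 * L / couplingConst L M with hA
  set B := constB L M (couplingConst L M * y ^ 2) (y ^ 3)
  set ℓ := Real.log (1 / δ) with hℓ
  have hℓ0 : 0 ≤ ℓ := Real.log_nonneg (one_le_one_div hδ hδ1.le)
  have hA0 : 0 < A := by positivity
  have hD0 : 0 < D := by positivity
  set m := 1 + Δ + ℓ with hm
  have hy2 : y ^ 6 ≤ y ^ 2 := pow_le_pow_of_le_one hy.le hy1 (by norm_num)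
  have hy5 : y ^ 5 ≤ y ^ 2 := pow_le_pow_of_le_one hy.le hy1 (by norm_num)
  have e1 : (1 + 1 / (((2 : ℕ) : ℝ) - 1)) = (2 : ℕ) := by norm_num
  have e2 : (1 / (((2 : ℕ) : ℝ) - 1)) = 1 := by norm_num
  have e3 : (1 / ((2 : ℕ) : ℝ)) = 1 / 2 := by norm_num
  rw [e1, e2, e3, Real.rpow_one, Real.rpow_natCast, ← Real.sqrt_eq_rpow]
  have hsq : √(Δ / (y ^ 6 / (6 * L))) = √(6 * L) * √Δ / y ^ 3 := by
    rw [show Δ / (y ^ 6 / (6 * L)) = (6 * L) * Δ / (y ^ 3) ^ 2 by field_simp,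
      Real.sqrt_div (by positivity), Real.sqrt_sq (by positivity), Real.sqrt_mul (by positivity)]
  have hΔm : √Δ ≤ m := (sqrt_le_one_add hΔ).trans (by linarith)
  have hm1 : 1 ≤ m := by linarith
  have hℓm : ℓ ≤ m := by linarith
  -- For η = 2 the entries are C log(1/δ), 8C√(Δ/C_ε) and 16C²B, of orders y⁻², y⁻²y⁻³ and y⁻⁴y⁻¹;
  -- hence y⁻⁵ for y ≤ 1.
  have hK : max (A / y ^ 2 * ℓ) (max (4 * ((2 : ℕ) : ℝ) * (A / y ^ 2) * √(Δ / (y ^ 6 / (6 * L))))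
      (4 * ((2 : ℕ) : ℝ) ^ 2 * (A / y ^ 2) ^ 2 * B)) ≤
      A * (1 + 8 * √(6 * L) + 16 * A * D) * m / y ^ 5 := by
    have hs : 0 ≤ √(6 * L) := Real.sqrt_nonneg _
    refine max_le ?_ (max_le ?_ ?_)
    · calc A / y ^ 2 * ℓ ≤ A / y ^ 5 * m := by gcongr
        _ = A * 1 * m / y ^ 5 := by ring
        _ ≤ _ := by
          gcongr
          nlinarith [mul_pos hA0 hD0]
    · rw [hsq]
      calc _ = A * (8 * √(6 * L)) * √Δ / y ^ 5 := by push_cast; field_simp; ring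
        _ ≤ A * (1 + 8 * √(6 * L) + 16 * A * D) * m / y ^ 5 := by
          gcongr
          nlinarith [mul_pos hA0 hD0]
    · calc _ ≤ 4 * ((2 : ℕ) : ℝ) ^ 2 * (A / y ^ 2) ^ 2 * (D / y) := by gcongr
        _ = A * (16 * A * D) * 1 / y ^ 5 := by push_cast; field_simp; ring
        _ ≤ _ := by
          gcongr
          linarith
  calc _ ≤ 2 * (Δ / (y ^ 6 / (6 * L)))
          + D / y * (A * (1 + 8 * √(6 * L) + 16 * A * D) * m / y ^ 5) := by
        gcongr
    _ = (12 * L * Δ + D * A * (1 + 8 * √(6 * L) + 16 * A * D) * m) / y ^ 6 := by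
        field_simp
        ring
    _ ≤ (12 * L * m + D * A * (1 + 8 * √(6 * L) + 16 * A * D) * m) / y ^ 6 := by
        gcongr
        linarith
    _ = _ := by ring

lemma iterBound_nonneg (hL : 0 < L) (hM : 0 < M) {εg εH : ℝ} (hεg : 0 < εg) (hεH : 0 < εH)
    {Δ δ : ℝ} (hΔ : 0 ≤ Δ) (hδ : 0 < δ) (hδ1 : δ < 1) (η : ℕ) :
    0 ≤ iterBound L M εH εg εH Δ δ η := by
  have hℓ0 : 0 ≤ Real.log (1 / δ) := Real.log_nonneg (one_le_one_div hδ hδ1.le)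
  have hK : 0 ≤ constK L M εH εg εH Δ δ η :=
    le_max_of_le_left (mul_nonneg (by unfold constC; positivity) hℓ0)
  have hc : 0 ≤ decrease L M εg εH := le_min (by positivity) (by positivity)
  have hB : 0 ≤ constB L M εH εg := by unfold constB; positivity
  unfold iterBound
  positivity

/-- The iteration bound is `O(ε⁻²)`, uniformly in the initial gap and the failure probability. -/
lemma exists_iterBound_le (hL : 0 < L) (hM : 0 < M) {εH : ℝ → ℝ}
    (hεH : ∀ ε : ℝ, 0 < ε → εH ε = couplingConst L M * (ε ^ (1 / 3 : ℝ)) ^ 2) :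
    ∃ c : ℝ, ∀ ε Δ δ : ℝ, 0 < ε → ε < 1 → 0 ≤ Δ → 0 < δ → δ < 1 →
      iterBound L M (εH ε) ε (εH ε) Δ δ 2 ≤ c * (1 + Δ + Real.log (1 / δ)) * (1 / ε ^ 2) := by
  refine ⟨12 * L + (1 + 18 * couplingConst L M * L / M) * (3072 * L / couplingConst L M) *
    (1 + 8 * √(6 * L) + 16 * (3072 * L / couplingConst L M) *
      (1 + 18 * couplingConst L M * L / M)), fun ε Δ δ hε hε1 hΔ hδ hδ1 => ?_⟩
  have h1 := iterBound_le hL hM (Real.rpow_pos_of_pos hε (1 / 3))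
    (Real.rpow_le_one hε.le hε1.le (by norm_num)) hΔ hδ hδ1
  rw [← hεH ε hε, rpow_third_pow_three hε, pow_mul _ 3 2, rpow_third_pow_three hε] at h1
  rw [mul_one_div]
  exact h1

lemma eventually_pos_lt_one : ∀ᶠ ε : ℝ in 𝓝[>] 0, 0 < ε ∧ ε < 1 :=
  Ioo_mem_nhdsGT one_pos

end Asymptotics

end InexactSOSP

/-! ### The corollary -/

theorem mainTheorem5
    (L M : ℝ) (hL : 0 < L) (hM : 0 < M)
    (εH : ℝ → ℝ) (hεH : ∀ ε : ℝ, 0 < ε → 0 < εH ε)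
    (hcoupling : ∀ ε : ℝ, 0 < ε → ε ^ 2 / (6 * L) = 2 * εH ε ^ 3 / (9 * M ^ 2)) :
    -- the size of `ε_H`, `C` and `B` when `ε_g = ε → 0` and `α = ε_H`
    (εH =Θ[𝓝[>] (0 : ℝ)] fun ε => ε ^ (2 / 3 : ℝ)) ∧
    ((fun ε => InexactSOSP.constC M (εH ε) ε (εH ε)) =O[𝓝[>] (0 : ℝ)] fun ε => 1 / εH ε) ∧
    ((fun ε => InexactSOSP.constC M (εH ε) ε (εH ε)) =O[𝓝[>] (0 : ℝ)]
      fun ε => 1 / ε ^ (2 / 3 : ℝ)) ∧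
    ((fun ε => InexactSOSP.constB L M (εH ε) ε) =O[𝓝[>] (0 : ℝ)] fun ε => 1 / ε ^ (1 / 3 : ℝ)) ∧
    -- `n = Õ(1 / ε²)` for `η = 2`
    (∀ Δ δ : ℝ, 0 ≤ Δ → 0 < δ → δ < 1 →
      InexactSOSP.IsBigOTilde (𝓝[>] (0 : ℝ))
        (fun ε => InexactSOSP.iterBound L M (εH ε) ε (εH ε) Δ δ 2) (fun ε => 1 / ε ^ 2)) ∧
    -- the same with constants that depend on `L` and `M` only
    (∃ c ε₀ : ℝ, ∃ k : ℕ, 0 < ε₀ ∧ ∀ ε Δ δ : ℝ, 0 < ε → ε < ε₀ → 0 ≤ Δ → 0 < δ → δ < 1 →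
      InexactSOSP.iterBound L M (εH ε) ε (εH ε) Δ δ 2 ≤
        c * (1 + Δ + Real.log (1 / δ)) * (1 / ε ^ 2 * Real.log (1 / ε ^ 2) ^ k)) ∧
    -- the algorithm terminates within `n` iterations with probability at least `1 - δ`
    (∀ (ε δ : ℝ), 0 < ε → 0 < δ → δ < 1 →
      ∀ (d : ℕ) (S : Set (InexactSOSP.Vec d)) (f : InexactSOSP.Vec d → ℝ) (fbar : ℝ)
        (x₀ : InexactSOSP.Vec d),
      InexactSOSP.SmoothObjective S f L M fbar →
      ∀ (Ω : Type*) [mΩ : MeasurableSpace Ω] (μ : Measure Ω) [IsProbabilityMeasure μ]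
        (ℱ : Filtration ℕ mΩ) (σ : ℕ → Ω → ℝ) (r : ℕ → Ω → InexactSOSP.Reply d),
      InexactSOSP.FairSigns μ ℱ σ →
      InexactSOSP.AdaptedReplies ℱ r →
      InexactSOSP.ValidRun S f L M ε (εH ε) (εH ε) x₀ r σ →
      1 - δ ≤ μ.real {ω | InexactSOSP.TerminatesWithin ε (εH ε) r
        (InexactSOSP.iterBound L M (εH ε) ε (εH ε) (f x₀ - fbar) δ 2) ω}) := by
  have heq : ∀ ε : ℝ, 0 < ε → εH ε = InexactSOSP.couplingConst L M * (ε ^ (1 / 3 : ℝ)) ^ 2 :=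
    fun ε hε => InexactSOSP.eq_couplingConst_mul hL hM (Real.rpow_pos_of_pos hε _) (hεH ε hε)
      (by rw [InexactSOSP.rpow_third_pow_three hε]; exact hcoupling ε hε)
  have hκ := InexactSOSP.couplingConst_pos hL hM
  have hCeq : ∀ ε : ℝ, 0 < ε → InexactSOSP.constC M (εH ε) ε (εH ε)
      = 3072 * L / InexactSOSP.couplingConst L M / (ε ^ (1 / 3 : ℝ)) ^ 2 := by
    intro ε hε
    have h1 := InexactSOSP.constC_eq hL hM (Real.rpow_pos_of_pos hε (1 / 3))
    rwa [← heq ε hε, InexactSOSP.rpow_third_pow_three hε] at h1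
  obtain ⟨c, hc⟩ := InexactSOSP.exists_iterBound_le hL hM heq
  refine ⟨?_, ?_, ?_, ?_, ?_, ?_, ?_⟩
  · have h1 : εH =ᶠ[𝓝[>] 0] fun ε => InexactSOSP.couplingConst L M * ε ^ (2 / 3 : ℝ) := by
      filter_upwards [self_mem_nhdsWithin] with ε hε
      rw [heq ε hε, InexactSOSP.rpow_two_thirds hε]
    exact h1.trans_isTheta ((isTheta_const_mul_left hκ.ne').2 (isTheta_refl _ _))
  · refine IsBigO.of_bound (3072 * L) ?_
    filter_upwards [self_mem_nhdsWithin] with ε (hε : 0 < ε)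
    have hy := Real.rpow_pos_of_pos hε (1 / 3)
    rw [hCeq ε hε, heq ε hε, Real.norm_of_nonneg (by positivity),
      Real.norm_of_nonneg (by positivity)]
    exact le_of_eq (by field_simp)
  · refine IsBigO.of_bound (3072 * L / InexactSOSP.couplingConst L M) ?_
    filter_upwards [self_mem_nhdsWithin] with ε (hε : 0 < ε)
    have hy := Real.rpow_pos_of_pos hε (1 / 3)
    rw [hCeq ε hε, InexactSOSP.rpow_two_thirds hε, Real.norm_of_nonneg (by positivity),
      Real.norm_of_nonneg (by positivity), mul_one_div]
  · refine IsBigO.of_bound (1 + 18 * InexactSOSP.couplingConst L M * L / M) ?_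
    filter_upwards [InexactSOSP.eventually_pos_lt_one] with ε hε
    have hy := Real.rpow_pos_of_pos hε.1 (1 / 3)
    have h1 := InexactSOSP.constB_le (L := L) hM hy
      (Real.rpow_le_one hε.1.le hε.2.le (by norm_num))
    have h2 := InexactSOSP.constB_eq (L := L) hM hy
    rw [← heq ε hε.1, InexactSOSP.rpow_third_pow_three hε.1] at h1 h2
    rw [Real.norm_of_nonneg (by rw [h2]; positivity), Real.norm_of_nonneg (by positivity),
      mul_one_div]
    exact h1
  · intro Δ δ hΔ hδ hδ1
    -- The exponent of the logarithm can be 0, since the bound is a true O(ε⁻²).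
    refine ⟨0, IsBigO.of_bound (c * (1 + Δ + Real.log (1 / δ))) ?_⟩
    filter_upwards [InexactSOSP.eventually_pos_lt_one] with ε hε
    rw [pow_zero, mul_one, Real.norm_of_nonneg
      (InexactSOSP.iterBound_nonneg hL hM hε.1 (hεH ε hε.1) hΔ hδ hδ1 2),
      Real.norm_of_nonneg (by positivity)]
    exact hc ε Δ δ hε.1 hε.2 hΔ hδ hδ1
  · refine ⟨c, 1, 0, one_pos, fun ε Δ δ hε hε1 hΔ hδ hδ1 => ?_⟩
    rw [pow_zero, mul_one]
    exact hc ε Δ δ hε hε1 hΔ hδ hδ1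
  · intro ε δ hε hδ hδ1 d S f fbar x₀ h Ω mΩ μ _ ℱ σ r hσ hr hrun
    exact hrun.le_measure_terminatesWithin h hL hM hε (hεH ε hε) (hcoupling ε hε) hσ hr hδ hδ1 2
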